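/- Bounded arithmetic is formulated in the language with $\le$ and function symbols for all polynomial time computable functions: those of Buss's language $0,S,+,\cdot,\#,|x|,\lfloor x/2\rfloor$, closed under projections, composition and limited recursion on notation. $S^i_2$ (respectively $T^i_2$) consists of Buss's axioms BASIC, the defining equations of the polynomial time function symbols, and polynomial induction $A(0)\wedge\forall a\,(A(\lfloor a/2\rfloor)\to A(a))\to\forall a\,A(a)$ (respectively induction $A(0)\wedge\forall a\,(A(a)\to A(a+1))\to\forall a\,A(a)$) for all $\Sigma^b_i$-formulas $A$ of this language. An nPLS problem $\mathcal P=\langle d;\mathcal S,\mathcal T,\mathcal N;N,i,t,c,S,U,rk\rangle$ in $S^1_2$ consists of a polynomial $d$ with natural number coefficients, polynomial time predicates $\mathcal S(x,s)$ (sources), $\mathcal T(x,s,t)$ (targets), $\mathcal N(x,s,y,z)$ (neighborhoods), and polynomial time functions $N(x,s,y)$, $i(x)$, $t(x,s)$, $c(x,y)$, $S(x,s,y)$, $U(x,s,y,z)$, $rk(x,s)$, such that, writing $s\in\mathcal S(x)$ for $\mathcal S(x,s)$ and $y\in\mathcal T(x,s)$ for $\mathcal T(x,s,y)$, the following are all provable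 in $S^1_2$: 1. $s\in\mathcal S(x)\to|s|\le d(|x|)$, and $y\in\mathcal T(x,s)\to|y|\le d(|x|)$; 2. $y\in\mathcal T(x,s)\to S(x,s,y)\in\mathcal S(x)$; 3. $\mathcal N(x,s,y,z)\to s\in\mathcal S(x)\wedge y\in\mathcal T(x,s)\wedge z\in\mathcal T(x,s)$; 4. $rk(x,s)=0\to[\mathcal N(x,s,y,z)\leftrightarrow N(x,s,y)=z\wedge y\in\mathcal T(x,s)]$; 5. $rk(x,s)>0\wedge y\in\mathcal T(x,s)\to\mathcal N(x,s,y,y)\vee rk(x,S(x,s,y))<rk(x,s)$; 6. $rk(x,s)>0\wedge\mathcal N(x,S(x,s,y),z,z)\to\mathcal N(x,s,y,U(x,s,y,z))$; 7. $i(x)\in\mathcal S(x)$, and $s\in\mathcal S(x)\to t(x,s)\in\mathcal T(x,s)$; 8. $\mathcal N(x,s,y,z)\to y=z\vee c(x,y)>c(x,z)$. Write $y=\mathcal P(x)$ for $\mathcal N(x,i(x),y,y)$. Lemma 1. For every nPLS problem $\mathcal P$ in $S^1_2$, $$T^2_2\vdash\forall x\,\exists y<2^{d(|x|)}\,[\,y=\mathcal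 P(x)\,].$$ -/

import Mathlib

open FirstOrder FirstOrder.Language Polynomial

namespace BoundedArith

/-- Function symbols of bounded arithmetic with polynomial time functions, indexed by arity: the
symbols of Buss's language (`smash` is `x # y = 2 ^ (|x| * |y|)`, `half` is `⌊x / 2⌋`, `len` is the
binary length `|x|`), closed under projections, composition and limited recursion on notation.
By Cobham's theorem these are names for exactly the polynomial time computable functions. -/
inductive PV : ℕ → Type
  | zero : PV 0
  | succ : PV 1
  | half : PV 1
  | len : PV 1
  | add : PV 2
  | mul : PV 2
  | smash : PV 2
  | proj {n : ℕ} (i : Fin n) : PV n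
  | comp {n m : ℕ} (f : PV m) (g : Fin m → PV n) : PV n
  | limRec {n : ℕ} (g : PV n) (h₀ h₁ : PV (n + 2)) (k : PV (n + 1)) : PV (n + 1)

/-- The first-order language with the function symbols `PV` and the relation symbol `≤`. -/
abbrev Lang : FirstOrder.Language.{0, 0} := ⟨PV, orderRel⟩

instance : Lang.IsOrdered := ⟨orderRel.le⟩

section Terms

variable {β : Type}

/-- Application of a function symbol to terms. -/
def app {n : ℕ} (f : PV n) (ts : Fin n → Lang.Term β) : Lang.Term β :=
  Term.func (L := Lang) f ts

instance : Zero (Lang.Term β) := ⟨app .zero ![]⟩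
instance : Add (Lang.Term β) := ⟨fun a b => app .add ![a, b]⟩
instance : Mul (Lang.Term β) := ⟨fun a b => app .mul ![a, b]⟩

def succ (a : Lang.Term β) : Lang.Term β := app .succ ![a]
def half (a : Lang.Term β) : Lang.Term β := app .half ![a]
def len (a : Lang.Term β) : Lang.Term β := app .len ![a]
def smash (a b : Lang.Term β) : Lang.Term β := app .smash ![a, b]

instance : One (Lang.Term β) := ⟨succ 0⟩

/-- The term `2 · a`, with `2 = S S 0`. -/
def dbl (a : Lang.Term β) : Lang.Term β := succ (succ 0) * a

/-- The numeral `S ⋯ S 0`. -/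
def num : ℕ → Lang.Term β
  | 0 => 0
  | k + 1 => succ (num k)

/-- The coefficients `a₀, …, a_deg` of a polynomial with natural number coefficients. -/
noncomputable def coeffList (d : ℕ[X]) : List ℕ :=
  (List.range (d.natDegree + 1)).map d.coeff

/-- Horner form `a₀ + b · (a₁ + b · (⋯))`. -/
def horner (b : Lang.Term β) : List ℕ → Lang.Term β
  | [] => 0
  | a :: l => num a + b * horner b l

/-- `pow2Horner x [a₀, a₁, …]` denotes `2 ^ (a₀ + |x| · (a₁ + |x| · (⋯)))`: if `u` denotes `2 ^ e`,
then `⌊u / 2⌋ # x` denotes `2 ^ (e · |x|)`, which is then doubled `a₀` times. -/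
def pow2Horner (x : Lang.Term β) : List ℕ → Lang.Term β
  | [] => 1
  | a :: l => dbl^[a] (smash (half (pow2Horner x l)) x)

/-- The term `d(b)`. -/
noncomputable def polyTerm (d : ℕ[X]) (b : Lang.Term β) : Lang.Term β := horner b (coeffList d)

/-- The term `2 ^ d(|x|)`. -/
noncomputable def pow2Term (d : ℕ[X]) (x : Lang.Term β) : Lang.Term β :=
  pow2Horner x (coeffList d)

end Terms

section Axioms

/-- `a < b`, that is, `a ≤ b ∧ a ≠ b`. -/
def lt {α : Type} {n : ℕ} (a b : Lang.Term (α ⊕ Fin n)) : Lang.BoundedFormula α n :=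
  a.le b ⊓ ∼(a =' b)

/-- Buss's axioms `BASIC`, in the variables `x, y, u, v`. -/
def basicAxioms (x y u v : Lang.Term (Empty ⊕ Fin 4)) : List (Lang.BoundedFormula Empty 4) :=
  [ y.le x ⟹ y.le (succ x),
    ∼(x =' succ x),
    Term.le 0 x,
    (x.le y ⊓ ∼(x =' y)) ⇔ (succ x).le y,
    ∼(x =' 0) ⟹ ∼(dbl x =' 0),
    y.le x ⊔ x.le y,
    (x.le y ⊓ y.le x) ⟹ x =' y,
    (x.le y ⊓ y.le u) ⟹ x.le u,
    len 0 =' (0 : Lang.Term (Empty ⊕ Fin 4)),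
    ∼(x =' 0) ⟹ (len (dbl x) =' succ (len x) ⊓ len (succ (dbl x)) =' succ (len x)),
    len 1 =' (1 : Lang.Term (Empty ⊕ Fin 4)),
    x.le y ⟹ (len x).le (len y),
    len (smash x y) =' succ (len x * len y),
    smash 0 y =' 1,
    ∼(x =' 0) ⟹ (smash 1 (dbl x) =' dbl (smash 1 x) ⊓
      smash 1 (succ (dbl x)) =' dbl (smash 1 x)),
    smash x y =' smash y x,
    len x =' len y ⟹ smash x u =' smash y u,
    len x =' (len u + len v) ⟹ smash x y =' (smash u y * smash v y),
    x.le (x + y),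
    (x.le y ⊓ ∼(x =' y)) ⟹ ((succ (dbl x)).le (dbl y) ⊓ ∼(succ (dbl x) =' dbl y)),
    (x + y) =' (y + x),
    (x + 0) =' x,
    (x + succ y) =' succ (x + y),
    ((x + y) + u) =' (x + (y + u)),
    (x + y).le (x + u) ⇔ y.le u,
    (x * 0) =' 0,
    (x * succ y) =' (x * y + x),
    (x * y) =' (y * x),
    (x * (y + u)) =' (x * y + x * u),
    Term.le 1 x ⟹ ((x * y).le (x * u) ⇔ y.le u),
    ∼(x =' 0) ⟹ len x =' succ (len (half x)),
    x =' half y ⇔ (dbl x =' y ⊔ succ (dbl x) =' y) ]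

/-- The theory `BASIC`. -/
def BASIC : Lang.Theory := {σ | ∃ φ ∈ basicAxioms (&0) (&1) (&2) (&3), σ = φ.alls}

/-- `v` is `t` if `|t| ≤ |b|`, and `v` is `b` otherwise. -/
def limited {n : ℕ} (v t b : Lang.Term (Empty ⊕ Fin n)) : Lang.BoundedFormula Empty n :=
  ((len t).le (len b) ⟹ v =' t) ⊓ (∼((len t).le (len b)) ⟹ v =' b)

/-- The symbol `f = limRec g h₀ h₁ k` at `0`: `f(0, x⃗) = g(x⃗)`. -/
def recZero {n : ℕ} (g : PV n) (h₀ h₁ : PV (n + 2)) (k : PV (n + 1)) :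
    Lang.BoundedFormula Empty n :=
  app (.limRec g h₀ h₁ k) (Fin.cons 0 fun j => &j) =' app g (fun j => &j)

/-- The symbol `f = limRec g h₀ h₁ k` at even arguments: if `y ≠ 0`, then `f(2y, x⃗)` is
`h₀(y, f(y, x⃗), x⃗)`, limited by `k(2y, x⃗)`. -/
def recEven {n : ℕ} (g : PV n) (h₀ h₁ : PV (n + 2)) (k : PV (n + 1)) :
    Lang.BoundedFormula Empty (n + 1) :=
  let y : Lang.Term (Empty ⊕ Fin (n + 1)) := &0
  let x : Fin n → Lang.Term (Empty ⊕ Fin (n + 1)) := fun j => &j.succ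
  let f : PV (n + 1) := .limRec g h₀ h₁ k
  ∼(y =' 0) ⟹ limited (app f (Fin.cons (dbl y) x))
    (app h₀ (Fin.cons y (Fin.cons (app f (Fin.cons y x)) x)))
    (app k (Fin.cons (dbl y) x))

/-- The symbol `f = limRec g h₀ h₁ k` at odd arguments: `f(2y + 1, x⃗)` is `h₁(y, f(y, x⃗), x⃗)`,
limited by `k(2y + 1, x⃗)`. -/
def recOdd {n : ℕ} (g : PV n) (h₀ h₁ : PV (n + 2)) (k : PV (n + 1)) :
    Lang.BoundedFormula Empty (n + 1) :=
  let y : Lang.Term (Empty ⊕ Fin (n + 1)) := &0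
  let x : Fin n → Lang.Term (Empty ⊕ Fin (n + 1)) := fun j => &j.succ
  let f : PV (n + 1) := .limRec g h₀ h₁ k
  limited (app f (Fin.cons (succ (dbl y)) x))
    (app h₁ (Fin.cons y (Fin.cons (app f (Fin.cons y x)) x)))
    (app k (Fin.cons (succ (dbl y)) x))

/-- The defining equations of the projection, composition and recursion symbols. -/
inductive PVAxiom : Lang.Sentence → Prop
  | proj {n : ℕ} (i : Fin n) :
      PVAxiom (app (.proj i) (fun j => &j) =' (&i : Lang.Term (Empty ⊕ Fin n))).alls
  | comp {n m : ℕ} (f : PV m) (g : Fin m → PV n) :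
      PVAxiom (app (.comp f g) (fun j => (&j : Lang.Term (Empty ⊕ Fin n))) ='
        app f (fun l => app (g l) (fun j => &j))).alls
  | rec_zero {n : ℕ} (g : PV n) (h₀ h₁ : PV (n + 2)) (k : PV (n + 1)) :
      PVAxiom (recZero g h₀ h₁ k).alls
  | rec_even {n : ℕ} (g : PV n) (h₀ h₁ : PV (n + 2)) (k : PV (n + 1)) :
      PVAxiom (recEven g h₀ h₁ k).alls
  | rec_odd {n : ℕ} (g : PV n) (h₀ h₁ : PV (n + 2)) (k : PV (n + 1)) :
      PVAxiom (recOdd g h₀ h₁ k).alls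

/-- The polarities of the bounded hierarchy. -/
inductive Pol
  | sigma
  | pi

/-- The opposite polarity. -/
def Pol.dual : Pol → Pol
  | .sigma => .pi
  | .pi => .sigma

/-- The atomic formula `v ≤ t` for the innermost variable `v` and a term `t` not containing it. -/
def lastLe {α : Type} {n : ℕ} (t : Lang.Term (α ⊕ Fin n)) : Lang.BoundedFormula α (n + 1) :=
  Term.le (&(Fin.last n)) (t.relabel (Sum.map id Fin.castSucc))

/-- `∀ v ≤ t, φ`. -/
def ballLe {α : Type} {n : ℕ} (t : Lang.Term (α ⊕ Fin n)) (φ : Lang.BoundedFormula α (n + 1)) :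
    Lang.BoundedFormula α n :=
  ∀' (lastLe t ⟹ φ)

/-- `∃ v ≤ t, φ`. -/
def bexLe {α : Type} {n : ℕ} (t : Lang.Term (α ⊕ Fin n)) (φ : Lang.BoundedFormula α (n + 1)) :
    Lang.BoundedFormula α n :=
  ∃' (lastLe t ⊓ φ)

/-- The bounded hierarchy: `Hier .sigma i` is the class `Σᵇᵢ` and `Hier .pi i` the class `Πᵇᵢ`.
For `i = 0` both are the formulas whose quantifiers are all sharply bounded, and `Σᵇᵢ₊₁` contains
`Σᵇᵢ` and `Πᵇᵢ` and is closed under sharply bounded quantifiers, bounded existential quantifiers,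
and the connectives, with antecedents from `Πᵇᵢ₊₁` (the other connectives are abbreviations by
implication and falsity); dually for `Πᵇᵢ₊₁`. -/
inductive Hier {α : Type} : Pol → ℕ → ∀ {n : ℕ}, Lang.BoundedFormula α n → Prop
  | falsum (p : Pol) (i n : ℕ) : Hier p i (⊥ : Lang.BoundedFormula α n)
  | equal (p : Pol) (i : ℕ) {n : ℕ} (s t : Lang.Term (α ⊕ Fin n)) : Hier p i (s =' t)
  | le (p : Pol) (i : ℕ) {n : ℕ} (s t : Lang.Term (α ⊕ Fin n)) : Hier p i (s.le t)
  | imp {p : Pol} {i n : ℕ} {φ ψ : Lang.BoundedFormula α n} :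
      Hier p.dual i φ → Hier p i ψ → Hier p i (φ ⟹ ψ)
  | sharpAll {p : Pol} {i n : ℕ} (t : Lang.Term (α ⊕ Fin n))
      {φ : Lang.BoundedFormula α (n + 1)} : Hier p i φ → Hier p i (ballLe (len t) φ)
  | sharpEx {p : Pol} {i n : ℕ} (t : Lang.Term (α ⊕ Fin n))
      {φ : Lang.BoundedFormula α (n + 1)} : Hier p i φ → Hier p i (bexLe (len t) φ)
  | boundedAll {i n : ℕ} (t : Lang.Term (α ⊕ Fin n)) {φ : Lang.BoundedFormula α (n + 1)} :
      Hier .pi (i + 1) φ → Hier .pi (i + 1) (ballLe t φ)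
  | boundedEx {i n : ℕ} (t : Lang.Term (α ⊕ Fin n)) {φ : Lang.BoundedFormula α (n + 1)} :
      Hier .sigma (i + 1) φ → Hier .sigma (i + 1) (bexLe t φ)
  | lift {p : Pol} (q : Pol) {i n : ℕ} {φ : Lang.BoundedFormula α n} :
      Hier p i φ → Hier q (i + 1) φ

/-- The universal closure of a formula. -/
noncomputable def closure {n : ℕ} (φ : Lang.Formula (Fin n)) : Lang.Sentence :=
  Formula.iAlls (Fin n) (φ.relabel (Sum.inr : Fin n → Empty ⊕ Fin n))

/-- `∀ a, φ(a)` for a formula `φ(a)` with parameters, where `a` is the variable `inr ()`. -/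
noncomputable def allInd {n : ℕ} (φ : Lang.Formula (Fin n ⊕ Unit)) : Lang.Formula (Fin n) :=
  Formula.iAlls Unit φ

/-- `φ(0)`. -/
def atZero {n : ℕ} (φ : Lang.Formula (Fin n ⊕ Unit)) : Lang.Formula (Fin n) :=
  BoundedFormula.subst φ (Sum.elim Term.var fun _ => 0)

/-- `φ(S a)`. -/
def atSucc {n : ℕ} (φ : Lang.Formula (Fin n ⊕ Unit)) : Lang.Formula (Fin n ⊕ Unit) :=
  BoundedFormula.subst φ
    (Sum.elim (fun j => Term.var (Sum.inl j)) fun _ => succ (Term.var (Sum.inr ())))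

/-- `φ(⌊a / 2⌋)`. -/
def atHalf {n : ℕ} (φ : Lang.Formula (Fin n ⊕ Unit)) : Lang.Formula (Fin n ⊕ Unit) :=
  BoundedFormula.subst φ
    (Sum.elim (fun j => Term.var (Sum.inl j)) fun _ => half (Term.var (Sum.inr ())))

/-- The induction axiom for `φ`: `φ(0) ∧ ∀ a (φ(a) → φ(S a)) → ∀ a, φ(a)`. -/
noncomputable def indAxiom {n : ℕ} (φ : Lang.Formula (Fin n ⊕ Unit)) : Lang.Sentence :=
  closure ((atZero φ ⊓ allInd (φ ⟹ atSucc φ)) ⟹ allInd φ)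

/-- The polynomial induction axiom for `φ`: `φ(0) ∧ ∀ a (φ(⌊a / 2⌋) → φ(a)) → ∀ a, φ(a)`. -/
noncomputable def pindAxiom {n : ℕ} (φ : Lang.Formula (Fin n ⊕ Unit)) : Lang.Sentence :=
  closure ((atZero φ ⊓ allInd (atHalf φ ⟹ φ)) ⟹ allInd φ)

/-- The theory `S^i_2` in the language with the polynomial time function symbols. -/
def S2 (i : ℕ) : Lang.Theory :=
  BASIC ∪ {σ | PVAxiom σ} ∪
    {σ | ∃ (n : ℕ) (φ : Lang.Formula (Fin n ⊕ Unit)), Hier .sigma i φ ∧ σ = pindAxiom φ}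

/-- The theory `T^i_2` in the language with the polynomial time function symbols. -/
def T2 (i : ℕ) : Lang.Theory :=
  BASIC ∪ {σ | PVAxiom σ} ∪
    {σ | ∃ (n : ℕ) (φ : Lang.Formula (Fin n ⊕ Unit)), Hier .sigma i φ ∧ σ = indAxiom φ}

end Axioms

/-- The data of a nested polynomial local search problem
`⟨d; 𝒮, 𝒯, 𝒩; N, i, t, c, S, U, rk⟩`. The polynomial time predicates `𝒮(x,s)`, `𝒯(x,s,t)`,
`𝒩(x,s,y,z)` are given by symbols for polynomial time functions, the predicate being that the
value is `1`. -/
structure NPLS where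
  /-- the polynomial bound -/
  d : ℕ[X]
  /-- sources `𝒮(x,s)` -/
  src : PV 2
  /-- targets `𝒯(x,s,t)` -/
  tgt : PV 3
  /-- neighbourhoods `𝒩(x,s,y,z)` -/
  nbh : PV 4
  /-- neighbourhood function `N(x,s,y)` for rank zero -/
  N : PV 3
  /-- initial source `i(x)` -/
  i : PV 1
  /-- initial target `t(x,s)` -/
  t : PV 2
  /-- cost `c(x,y)` -/
  c : PV 2
  /-- generated source `S(x,s,y)` -/
  S : PV 3
  /-- extracted result `U(x,s,y,z)` -/
  U : PV 4
  /-- rank `rk(x,s)` -/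
  rk : PV 2

namespace NPLS

variable (P : NPLS) {n : ℕ}

/-- `s ∈ 𝒮(x)`. -/
def Src (x s : Lang.Term (Empty ⊕ Fin n)) : Lang.BoundedFormula Empty n :=
  app P.src ![x, s] =' 1

/-- `t ∈ 𝒯(x,s)`. -/
def Tgt (x s t : Lang.Term (Empty ⊕ Fin n)) : Lang.BoundedFormula Empty n :=
  app P.tgt ![x, s, t] =' 1

/-- `𝒩(x,s,y,z)`. -/
def Nbh (x s y z : Lang.Term (Empty ⊕ Fin n)) : Lang.BoundedFormula Empty n :=
  app P.nbh ![x, s, y, z] =' 1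

/-- All conditions on an nPLS problem are theorems of the theory `Th`. The variables `x, s, y, z`
of the conditions are understood as universally quantified. By the completeness theorem, first-order
provability from `Th` is Mathlib's relation `Th ⊨ᵇ φ`. -/
structure IsIn (Th : Lang.Theory) (x s y z : Lang.Term (Empty ⊕ Fin 4)) : Prop where
  src_bound : Th ⊨ᵇ (P.Src x s ⟹ (len s).le (polyTerm P.d (len x)))
  tgt_bound : Th ⊨ᵇ (P.Tgt x s y ⟹ (len y).le (polyTerm P.d (len x)))
  gen_src : Th ⊨ᵇ (P.Tgt x s y ⟹ P.Src x (app P.S ![x, s, y]))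
  nbh_dom : Th ⊨ᵇ (P.Nbh x s y z ⟹ (P.Src x s ⊓ (P.Tgt x s y ⊓ P.Tgt x s z)))
  rank_zero : Th ⊨ᵇ (app P.rk ![x, s] =' 0 ⟹
    (P.Nbh x s y z ⇔ (app P.N ![x, s, y] =' z ⊓ P.Tgt x s y)))
  rank_pos : Th ⊨ᵇ ((lt 0 (app P.rk ![x, s]) ⊓ P.Tgt x s y) ⟹
    (P.Nbh x s y y ⊔ lt (app P.rk ![x, app P.S ![x, s, y] ]) (app P.rk ![x, s])))
  extract : Th ⊨ᵇ ((lt 0 (app P.rk ![x, s]) ⊓ P.Nbh x (app P.S ![x, s, y]) z z) ⟹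
    P.Nbh x s y (app P.U ![x, s, y, z]))
  init_src : Th ⊨ᵇ P.Src x (app P.i ![x])
  init_tgt : Th ⊨ᵇ (P.Src x s ⟹ P.Tgt x s (app P.t ![x, s]))
  cost : Th ⊨ᵇ (P.Nbh x s y z ⟹ (y =' z ⊔ lt (app P.c ![x, z]) (app P.c ![x, y])))

/-- `P` is an nPLS in the theory `Th`: its defining conditions are theorems of `Th`. -/
def IsNPLSIn (Th : Lang.Theory) : Prop := P.IsIn Th (&0) (&1) (&2) (&3)

/-- `y = 𝒫(x)`, that is, `𝒩(x, i(x), y, y)`. -/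
def Sol (x y : Lang.Term (Empty ⊕ Fin n)) : Lang.BoundedFormula Empty n :=
  P.Nbh x (app P.i ![x]) y y

/-- The sentence `∀ x ∃ y < 2 ^ d(|x|), y = 𝒫(x)`. -/
noncomputable def totality : Lang.Sentence :=
  ∀' ∃' (lt (&1) (pow2Term P.d (&0)) ⊓ P.Sol (&0) (&1))

end NPLS

end BoundedArith

/-! Work in an arbitrary model of `T2 2`; provability is semantic consequence, so this suffices.
Suppose some source has no solution. The Σᵇ₂ least number principle gives a source `s` of least rank
among those without solution, and the Σᵇ₁ principle gives a target `y` of `s` of least cost. Then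
`y` has no neighbour at all: a neighbour other than `y` would be cheaper, and `y` itself would be a
solution. But at rank zero `N` supplies a neighbour. At positive rank `S(x,s,y)` is a source of
smaller rank, so it has a solution, from which `U` extracts a neighbour of `y`. Either way this is a
contradiction (`exists_solution`).

Three facts support this argument. `exists_least` derives minimization from induction.
`models_S2_of_T2` shows that the model satisfies `S2 1`, so the nPLS conditions hold in it.
`lt_pow2Term` turns bounds on length into bounds by `2 ^ d(|x|)`, which makes every quantifier of
the search bounded and also yields the bound on the solution. -/

namespace BoundedArith

/-! ### Values of terms in a structure -/

section Values

variable {M : Type} [Lang.Structure M]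

/-- The value of a function symbol in a structure. -/
def fn {n : ℕ} (f : PV n) (v : Fin n → M) : M := Structure.funMap (L := Lang) f v

/-- The value of `0`. -/
def zeroV : M := fn .zero ![]

/-- The value of the successor. -/
def succV (a : M) : M := fn .succ ![a]

/-- The value of `⌊a / 2⌋`. -/
def halfV (a : M) : M := fn .half ![a]

/-- The value of `|a|`. -/
def lenV (a : M) : M := fn .len ![a]

/-- The value of `a + b`. -/
def addV (a b : M) : M := fn .add ![a, b]

/-- The value of `a · b`. -/
def mulV (a b : M) : M := fn .mul ![a, b]

/-- The value of `a # b`. -/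
def smashV (a b : M) : M := fn .smash ![a, b]

variable {β : Type} (v : β → M)

theorem realize_app {n : ℕ} (f : PV n) (ts : Fin n → Lang.Term β) :
    (app f ts).realize v = fn f fun i => (ts i).realize v := rfl

@[simp]
theorem realize_app_one (f : PV 1) (a : Lang.Term β) :
    (app f ![a]).realize v = fn f ![a.realize v] := by
  rw [realize_app]; congr 1; ext i; fin_cases i; rfl

@[simp]
theorem realize_app_two (f : PV 2) (a b : Lang.Term β) :
    (app f ![a, b]).realize v = fn f ![a.realize v, b.realize v] := by
  rw [realize_app]; congr 1; ext i; fin_cases i <;> rfl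

@[simp]
theorem realize_app_three (f : PV 3) (a b c : Lang.Term β) :
    (app f ![a, b, c]).realize v = fn f ![a.realize v, b.realize v, c.realize v] := by
  rw [realize_app]; congr 1; ext i; fin_cases i <;> rfl

@[simp]
theorem realize_app_four (f : PV 4) (a b c d : Lang.Term β) :
    (app f ![a, b, c, d]).realize v =
      fn f ![a.realize v, b.realize v, c.realize v, d.realize v] := by
  rw [realize_app]; congr 1; ext i; fin_cases i <;> rfl

@[simp]
theorem realize_zero : (0 : Lang.Term β).realize v = zeroV := by
  change (app .zero ![]).realize v = fn .zero ![]
  rw [realize_app]; congr 1; ext i; exact i.elim0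

@[simp]
theorem realize_succ (a : Lang.Term β) : (succ a).realize v = succV (a.realize v) :=
  realize_app_one v _ a

@[simp]
theorem realize_one : (1 : Lang.Term β).realize v = succV zeroV := by
  change (succ 0).realize v = _
  simp

@[simp]
theorem realize_half (a : Lang.Term β) : (half a).realize v = halfV (a.realize v) :=
  realize_app_one v _ a

@[simp]
theorem realize_len (a : Lang.Term β) : (len a).realize v = lenV (a.realize v) :=
  realize_app_one v _ a

@[simp]
theorem realize_add (a b : Lang.Term β) :
    (a + b).realize v = addV (a.realize v) (b.realize v) :=
  realize_app_two v _ a b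

@[simp]
theorem realize_mul (a b : Lang.Term β) :
    (a * b).realize v = mulV (a.realize v) (b.realize v) :=
  realize_app_two v _ a b

@[simp]
theorem realize_smash (a b : Lang.Term β) :
    (smash a b).realize v = smashV (a.realize v) (b.realize v) :=
  realize_app_two v _ a b

/-- The value of `2 · a`. -/
def dblV (a : M) : M := mulV (succV (succV zeroV)) a

@[simp]
theorem realize_dbl (a : Lang.Term β) : (dbl a).realize v = dblV (a.realize v) := by
  simp [dbl, dblV]

end Values

/-! ### Order, arithmetic and length in models of `BASIC` -/

section Basic

variable {M : Type} [Lang.Structure M]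

theorem realize_basicAxioms (hM : M ⊨ BASIC) {φ : Lang.BoundedFormula Empty 4}
    (h : φ ∈ basicAxioms (&0) (&1) (&2) (&3)) (v : Empty → M) (xs : Fin 4 → M) :
    φ.Realize v xs := by
  rw [Subsingleton.elim v default]
  exact BoundedFormula.realize_alls.1 (hM.realize_of_mem _ ⟨φ, h, rfl⟩) xs

/-- Axioms are cited below by their position in the list, counted from zero. -/
theorem realize_basicAxioms_getElem (hM : M ⊨ BASIC) (i : ℕ)
    (hi : i < (basicAxioms (&0) (&1) (&2) (&3)).length) (a b c d : M) :
    ((basicAxioms (&0) (&1) (&2) (&3))[i]).Realize (default : Empty → M) ![a, b, c, d] :=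
  realize_basicAxioms hM (List.getElem_mem hi) _ _

/-- The linear order of a model of `BASIC`. -/
@[reducible]
noncomputable def linearOrder (hM : M ⊨ BASIC) : LinearOrder M :=
  letI := Lang.leOfStructure M
  { le := (· ≤ ·)
    le_refl := fun a => by
      -- Reflexivity is not an axiom; it is totality at equal arguments.
      have := realize_basicAxioms_getElem hM 5 (by decide) a a a a
      simpa [basicAxioms] using this
    le_trans := fun a b c h₁ h₂ => by
      have := realize_basicAxioms_getElem hM 7 (by decide) a b c c
      simpa [basicAxioms, h₁, h₂] using this
    le_antisymm := fun a b h₁ h₂ => by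
      have := realize_basicAxioms_getElem hM 6 (by decide) a b a a
      simpa [basicAxioms, h₁, h₂] using this
    le_total := fun a b => by
      have := realize_basicAxioms_getElem hM 5 (by decide) b a a a
      simpa [basicAxioms] using this
    toDecidableLE := Classical.decRel _ }

end Basic

section Ordered

variable {M : Type} [Lang.Structure M] [LinearOrder M] [Lang.OrderedStructure M]

@[simp]
theorem realize_lt {α : Type} {n : ℕ} (a b : Lang.Term (α ⊕ Fin n)) (v : α → M) (xs : Fin n → M) :
    (lt a b).Realize v xs ↔ a.realize (Sum.elim v xs) < b.realize (Sum.elim v xs) := by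
  simp [lt, lt_iff_le_and_ne]

theorem realize_bexLe {α : Type} {n : ℕ} (t : Lang.Term (α ⊕ Fin n))
    (φ : Lang.BoundedFormula α (n + 1)) (v : α → M) (xs : Fin n → M) :
    (bexLe t φ).Realize v xs ↔
      ∃ a ≤ t.realize (Sum.elim v xs), φ.Realize v (Fin.snoc xs a) := by
  simp [bexLe, lastLe, Function.comp_def, Sum.elim_map]

theorem realize_ballLe {α : Type} {n : ℕ} (t : Lang.Term (α ⊕ Fin n))
    (φ : Lang.BoundedFormula α (n + 1)) (v : α → M) (xs : Fin n → M) :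
    (ballLe t φ).Realize v xs ↔
      ∀ a ≤ t.realize (Sum.elim v xs), φ.Realize v (Fin.snoc xs a) := by
  simp [ballLe, lastLe, Function.comp_def, Sum.elim_map]

theorem zeroV_le (hM : M ⊨ BASIC) (a : M) : zeroV ≤ a := by
  simpa [basicAxioms] using realize_basicAxioms_getElem hM 2 (by decide) a a a a

theorem lt_iff_succV_le (hM : M ⊨ BASIC) {a b : M} : a < b ↔ succV a ≤ b := by
  simpa [basicAxioms, ← lt_iff_le_and_ne] using
    realize_basicAxioms_getElem hM 3 (by decide) a b a a

theorem le_lenV (hM : M ⊨ BASIC) {a b : M} (h : a ≤ b) : lenV a ≤ lenV b := by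
  have := realize_basicAxioms_getElem hM 11 (by decide) a b a a
  simpa [basicAxioms, h] using this

theorem le_addV (hM : M ⊨ BASIC) (a b : M) : a ≤ addV a b := by
  simpa [basicAxioms] using realize_basicAxioms_getElem hM 18 (by decide) a b a a

theorem addV_le_addV_iff (hM : M ⊨ BASIC) {a b c : M} : addV a b ≤ addV a c ↔ b ≤ c := by
  simpa [basicAxioms] using realize_basicAxioms_getElem hM 24 (by decide) a b c a

theorem lt_succV (hM : M ⊨ BASIC) (a : M) : a < succV a := (lt_iff_succV_le hM).2 le_rfl

theorem succV_ne_zeroV (hM : M ⊨ BASIC) (a : M) : succV a ≠ zeroV := fun h =>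
  ((lt_succV hM a).trans_le (h.trans_le (zeroV_le hM a))).false

theorem succV_injective (hM : M ⊨ BASIC) : Function.Injective (succV : M → M) := fun a b h => by
  rcases lt_trichotomy a b with hab | hab | hab
  · exact absurd ((lt_succV hM b).trans_le (h ▸ (lt_iff_succV_le hM).1 hab)) (lt_irrefl _)
  · exact hab
  · exact absurd ((lt_succV hM a).trans_le (h ▸ (lt_iff_succV_le hM).1 hab)) (lt_irrefl _)

end Ordered

section Basic

variable {M : Type} [Lang.Structure M]

theorem addV_comm (hM : M ⊨ BASIC) (a b : M) : addV a b = addV b a := by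
  simpa [basicAxioms] using realize_basicAxioms_getElem hM 20 (by decide) a b a a

theorem addV_zeroV (hM : M ⊨ BASIC) (a : M) : addV a zeroV = a := by
  simpa [basicAxioms] using realize_basicAxioms_getElem hM 21 (by decide) a a a a

theorem addV_succV (hM : M ⊨ BASIC) (a b : M) : addV a (succV b) = succV (addV a b) := by
  simpa [basicAxioms] using realize_basicAxioms_getElem hM 22 (by decide) a b a a

theorem succV_addV (hM : M ⊨ BASIC) (a b : M) : addV (succV a) b = succV (addV a b) := by
  rw [addV_comm hM, addV_succV hM, addV_comm hM]

theorem mulV_zeroV (hM : M ⊨ BASIC) (a : M) : mulV a zeroV = zeroV := by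
  simpa [basicAxioms] using realize_basicAxioms_getElem hM 25 (by decide) a a a a

theorem mulV_succV (hM : M ⊨ BASIC) (a b : M) : mulV a (succV b) = addV (mulV a b) a := by
  simpa [basicAxioms] using realize_basicAxioms_getElem hM 26 (by decide) a b a a

theorem mulV_comm (hM : M ⊨ BASIC) (a b : M) : mulV a b = mulV b a := by
  simpa [basicAxioms] using realize_basicAxioms_getElem hM 27 (by decide) a b a a

theorem dblV_eq (hM : M ⊨ BASIC) (a : M) : dblV a = addV a a := by
  rw [dblV, mulV_comm hM, mulV_succV hM, mulV_succV hM, mulV_zeroV hM, addV_comm hM zeroV,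
    addV_zeroV hM]

theorem lenV_zeroV (hM : M ⊨ BASIC) : lenV (zeroV : M) = zeroV := by
  simpa [basicAxioms] using
    realize_basicAxioms_getElem hM 8 (by decide) zeroV zeroV zeroV zeroV

theorem lenV_one (hM : M ⊨ BASIC) : lenV (succV zeroV : M) = succV zeroV := by
  simpa [basicAxioms] using
    realize_basicAxioms_getElem hM 10 (by decide) zeroV zeroV zeroV zeroV

theorem lenV_dblV (hM : M ⊨ BASIC) {a : M} (ha : a ≠ zeroV) : lenV (dblV a) = succV (lenV a) := by
  have := realize_basicAxioms_getElem hM 9 (by decide) a a a a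
  simp only [basicAxioms] at this
  simp [ha] at this
  exact this.1

theorem lenV_smashV (hM : M ⊨ BASIC) (a b : M) :
    lenV (smashV a b) = succV (mulV (lenV a) (lenV b)) := by
  simpa [basicAxioms] using realize_basicAxioms_getElem hM 12 (by decide) a b a a

theorem lenV_eq_succV_lenV_halfV (hM : M ⊨ BASIC) {a : M} (ha : a ≠ zeroV) :
    lenV a = succV (lenV (halfV a)) := by
  have := realize_basicAxioms_getElem hM 30 (by decide) a a a a
  simpa [basicAxioms, ha] using this

theorem dblV_halfV (hM : M ⊨ BASIC) (a : M) :
    dblV (halfV a) = a ∨ succV (dblV (halfV a)) = a := by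
  have := realize_basicAxioms_getElem hM 31 (by decide) (halfV a) a a a
  simpa [basicAxioms] using this

end Basic

section Ordered

variable {M : Type} [Lang.Structure M] [LinearOrder M] [Lang.OrderedStructure M]

/-- This strict descent lets a least counterexample refute a failure of polynomial induction. -/
theorem halfV_lt (hM : M ⊨ BASIC) {a : M} (ha : a ≠ zeroV) : halfV a < a := by
  have hle : halfV a ≤ dblV (halfV a) := by
    rw [dblV_eq hM]
    exact le_addV hM _ _
  rcases dblV_halfV hM a with h | h
  -- If `a` were its own half, then `a + a = a = a + 0`, and cancellation would give `a = 0`.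
  · refine lt_of_le_of_ne (hle.trans_eq h) fun hh => ha ?_
    rw [hh, dblV_eq hM] at h
    exact ((addV_le_addV_iff hM).1 (h.trans (addV_zeroV hM a).symm).le).antisymm (zeroV_le hM a)
  · exact (hle.trans_lt (lt_succV hM _)).trans_eq h

/-- A power `2 ^ e` has length `e + 1`. Halving leaves length `e`, smashing with `x` gives `e · |x|
+ 1`, and each doubling adds one, which matches a Horner step. -/
theorem lenV_pow2Horner (hM : M ⊨ BASIC) {β : Type} (v : β → M) (x : Lang.Term β) (l : List ℕ) :
    lenV ((pow2Horner x l).realize v) = succV ((horner (len x) l).realize v) := by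
  induction l with
  | nil => simp [pow2Horner, horner, lenV_one hM]
  | cons a l ih =>
    -- The length axioms for halving and doubling require a nonzero argument.
    have hne {u e : M} (h : lenV u = succV e) : u ≠ zeroV := by
      rintro rfl
      exact succV_ne_zeroV hM e (h.symm.trans (lenV_zeroV hM))
    have hhalf : lenV (halfV ((pow2Horner x l).realize v)) = (horner (len x) l).realize v :=
      succV_injective hM ((lenV_eq_succV_lenV_halfV hM (hne ih)).symm.trans ih)
    simp only [pow2Horner, horner, realize_add, realize_mul, realize_len]
    rw [mulV_comm hM, ← hhalf]
    induction a with
    | zero => simp [num, lenV_smashV hM, addV_comm hM zeroV, addV_zeroV hM]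
    | succ a iha =>
      rw [Function.iterate_succ_apply', realize_dbl, lenV_dblV hM (hne iha), iha, num,
        realize_succ, succV_addV hM]

theorem lt_pow2Term (hM : M ⊨ BASIC) {β : Type} (v : β → M) (d : ℕ[X]) (x : Lang.Term β) {a : M}
    (h : lenV a ≤ (polyTerm d (len x)).realize v) : a < (pow2Term d x).realize v := by
  -- Otherwise monotonicity of length would give `d(|x|) + 1 ≤ |a| ≤ d(|x|)`.
  by_contra hlt
  have := (le_lenV hM (not_lt.1 hlt)).trans h
  rw [pow2Term, lenV_pow2Horner hM] at this
  exact ((lt_succV hM _).trans_le this).false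

end Ordered
end BoundedArith

namespace BoundedArith

/-! ### Renaming variables preserves the bounded hierarchy -/

section Relabel

variable {α β : Type} {m : ℕ}

theorem relabel_len (g : α → β) (t : Lang.Term α) :
    (len t).relabel g = len (t.relabel g) := by
  simp only [len, app, Term.relabel]
  congr 1; ext i : 1; fin_cases i; rfl

theorem relabel_le (g : α → β ⊕ Fin m) {n : ℕ} (s t : Lang.Term (α ⊕ Fin n)) :
    (s.le t).relabel g = (s.relabel (BoundedFormula.relabelAux g n)).le
      (t.relabel (BoundedFormula.relabelAux g n)) := by
  simp only [Term.le, Relations.boundedFormula₂, Relations.boundedFormula, BoundedFormula.relabel,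
    BoundedFormula.mapTermRel, id]
  congr 1; ext i : 1; fin_cases i <;> rfl

theorem relabel_lastLe (g : α → β ⊕ Fin m) {n : ℕ} (t : Lang.Term (α ⊕ Fin n)) :
    (lastLe t).relabel g = lastLe (t.relabel (BoundedFormula.relabelAux g n)) := by
  rw [lastLe, relabel_le, lastLe]
  congr 1
  rw [Term.relabel_relabel, Term.relabel_relabel]
  congr 1
  ext (a | i)
  -- The bound does not mention the quantified variable, so renaming commutes with shifting past it,
  -- whether `g` keeps `a` free or makes it a bound index.
  · cases h : g a
    · simp [BoundedFormula.relabelAux, h]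
    · simp only [BoundedFormula.relabelAux, Function.comp_apply, Sum.map_inl, id, h,
        Equiv.sumAssoc_apply_inl_inr, Sum.map_inr, finSumFinEquiv_apply_left]
      rfl
  · simp [BoundedFormula.relabelAux]

theorem relabel_bexLe (g : α → β ⊕ Fin m) {n : ℕ} (t : Lang.Term (α ⊕ Fin n))
    (φ : Lang.BoundedFormula α (n + 1)) :
    (bexLe t φ).relabel g = bexLe (t.relabel (BoundedFormula.relabelAux g n)) (φ.relabel g) := by
  rw [bexLe, BoundedFormula.relabel_ex, bexLe, ← relabel_lastLe]
  rfl

theorem relabel_ballLe (g : α → β ⊕ Fin m) {n : ℕ} (t : Lang.Term (α ⊕ Fin n))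
    (φ : Lang.BoundedFormula α (n + 1)) :
    (ballLe t φ).relabel g = ballLe (t.relabel (BoundedFormula.relabelAux g n)) (φ.relabel g) := by
  rw [ballLe, BoundedFormula.relabel_all, ballLe, ← relabel_lastLe]
  rfl

/-- Needed because `complementary` places a formula under a new quantifier that captures its
induction variable. -/
theorem Hier.relabel (g : α → β ⊕ Fin m) {p : Pol} {i n : ℕ} {φ : Lang.BoundedFormula α n}
    (h : Hier p i φ) : Hier p i (φ.relabel g) := by
  induction h with
  | falsum => exact .falsum _ _ _
  | equal p i s t => exact .equal _ _ _ _
  | le p i s t => rw [relabel_le]; exact .le _ _ _ _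
  | imp _ _ h₁ h₂ => exact .imp h₁ h₂
  | sharpAll t _ ih => rw [relabel_ballLe, relabel_len]; exact .sharpAll _ ih
  | sharpEx t _ ih => rw [relabel_bexLe, relabel_len]; exact .sharpEx _ ih
  | boundedAll t _ ih => rw [relabel_ballLe]; exact .boundedAll _ ih
  | boundedEx t _ ih => rw [relabel_bexLe]; exact .boundedEx _ ih
  | lift q _ ih => exact .lift q ih

end Relabel

/-! ### Closure of the hierarchy under connectives -/

section Hier

variable {α : Type} {p : Pol} {i n : ℕ} {φ ψ : Lang.BoundedFormula α n}

theorem Pol.dual_dual (p : Pol) : p.dual.dual = p := by cases p <;> rfl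

theorem Hier.not (h : Hier p.dual i φ) : Hier p i (∼φ) := .imp h (.falsum _ _ _)

theorem Hier.inf (hφ : Hier p i φ) (hψ : Hier p i ψ) : Hier p i (φ ⊓ ψ) := by
  -- Conjunction abbreviates `∼(φ ⟹ ∼ψ)`, so each conjunct changes polarity twice.
  refine Hier.not (.imp ?_ (Hier.not ?_)) <;> rwa [Pol.dual_dual]

end Hier

/-! ### Semantics of the induction schemes -/

section Axioms

variable {M : Type} [Lang.Structure M] {n : ℕ}

theorem realize_closure (φ : Lang.Formula (Fin n)) :
    M ⊨ closure φ ↔ ∀ p : Fin n → M, φ.Realize p := by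
  unfold closure Sentence.Realize
  rw [Formula.realize_iAlls]
  refine forall_congr' fun p => ?_
  rw [Formula.realize_relabel]
  rfl

theorem realize_allInd (φ : Lang.Formula (Fin n ⊕ Unit)) (p : Fin n → M) :
    (allInd φ).Realize p ↔ ∀ a, φ.Realize (Sum.elim p fun _ => a) := by
  rw [allInd, Formula.realize_iAlls]
  exact ⟨fun h a => h fun _ => a, fun h a => h (a ())⟩

theorem realize_atZero (φ : Lang.Formula (Fin n ⊕ Unit)) (p : Fin n → M) :
    (atZero φ).Realize p ↔ φ.Realize (Sum.elim p fun _ => zeroV) := by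
  rw [atZero, Formula.Realize, BoundedFormula.realize_subst, Formula.Realize, iff_eq_eq]
  congr 1; ext (j | j) <;> simp

theorem realize_atSucc (φ : Lang.Formula (Fin n ⊕ Unit)) (p : Fin n → M) (a : M) :
    (atSucc φ).Realize (Sum.elim p fun _ => a) ↔ φ.Realize (Sum.elim p fun _ => succV a) := by
  rw [atSucc, Formula.Realize, BoundedFormula.realize_subst, Formula.Realize, iff_eq_eq]
  congr 1; ext (j | j) <;> simp

theorem realize_atHalf (φ : Lang.Formula (Fin n ⊕ Unit)) (p : Fin n → M) (a : M) :
    (atHalf φ).Realize (Sum.elim p fun _ => a) ↔ φ.Realize (Sum.elim p fun _ => halfV a) := by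
  rw [atHalf, Formula.Realize, BoundedFormula.realize_subst, Formula.Realize, iff_eq_eq]
  congr 1; ext (j | j) <;> simp

theorem realize_indAxiom (φ : Lang.Formula (Fin n ⊕ Unit)) :
    M ⊨ indAxiom φ ↔ ∀ p : Fin n → M, φ.Realize (Sum.elim p fun _ => zeroV) →
      (∀ a, φ.Realize (Sum.elim p fun _ => a) → φ.Realize (Sum.elim p fun _ => succV a)) →
      ∀ a, φ.Realize (Sum.elim p fun _ => a) := by
  simp [indAxiom, realize_closure, realize_allInd, realize_atZero, realize_atSucc]

theorem realize_pindAxiom (φ : Lang.Formula (Fin n ⊕ Unit)) :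
    M ⊨ pindAxiom φ ↔ ∀ p : Fin n → M, φ.Realize (Sum.elim p fun _ => zeroV) →
      (∀ a, φ.Realize (Sum.elim p fun _ => halfV a) → φ.Realize (Sum.elim p fun _ => a)) →
      ∀ a, φ.Realize (Sum.elim p fun _ => a) := by
  simp [pindAxiom, realize_closure, realize_allInd, realize_atZero, realize_atHalf]

theorem models_basic_of_T2 {i : ℕ} (hM : M ⊨ T2 i) : M ⊨ BASIC :=
  hM.mono (Set.subset_union_left.trans Set.subset_union_left)

end Axioms

/-! ### Least number principle, and `T2 (i + 2)` extends `S2 (i + 1)` -/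

section LeastNumber

variable {M : Type} [Lang.Structure M] [LinearOrder M] [Lang.OrderedStructure M]

/-- The formula `∃ v ≤ b, v + a ≤ b ∧ φ(v)`, where `b` is the last parameter. -/
def complementary {n : ℕ} (φ : Lang.Formula (Fin n ⊕ Unit)) :
    Lang.Formula (Fin (n + 1) ⊕ Unit) :=
  bexLe (Term.var (Sum.inl (Sum.inl (Fin.last n))))
    (Term.le (&0 + Term.var (Sum.inl (Sum.inr ()))) (Term.var (Sum.inl (Sum.inl (Fin.last n)))) ⊓
      BoundedFormula.relabel (n := 1) (k := 0)
        (Sum.elim (fun j => Sum.inl (Sum.inl j.castSucc)) fun _ => Sum.inr 0) φ)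

theorem Hier.complementary {i n : ℕ} {φ : Lang.Formula (Fin n ⊕ Unit)}
    (h : Hier .sigma (i + 1) φ) : Hier .sigma (i + 1) (complementary φ) :=
  .boundedEx _ (.inf (.le _ _ _ _) (h.relabel _))

theorem realize_complementary {n : ℕ} (φ : Lang.Formula (Fin n ⊕ Unit)) (p : Fin n → M) (a b : M) :
    (complementary φ).Realize (Sum.elim (Fin.snoc p b : Fin (n + 1) → M) fun _ => a) ↔
      ∃ v ≤ b, addV v a ≤ b ∧ φ.Realize (Sum.elim p fun _ => v) := by
  rw [complementary, Formula.Realize, realize_bexLe]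
  simp only [Term.realize_var, Sum.elim_inl, Fin.snoc_last, BoundedFormula.realize_inf,
    Term.realize_le, realize_add, Sum.elim_inr]
  refine exists_congr fun v => and_congr_right fun _ => and_congr Iff.rfl ?_
  refine BoundedFormula.realize_relabel.trans ?_
  rw [Formula.Realize, iff_eq_eq]
  congr 1
  · ext (j | j)
    · simp
    · rfl
  · ext i; exact i.elim0

/-- The least number principle for `Σᵇᵢ₊₁` formulas in models of `T^{i+1}_2`. -/
theorem exists_least {i n : ℕ} (hM : M ⊨ T2 (i + 1)) {φ : Lang.Formula (Fin n ⊕ Unit)}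
    (hφ : Hier .sigma (i + 1) φ) (p : Fin n → M) {b : M} (hb : φ.Realize (Sum.elim p fun _ => b)) :
    ∃ a, φ.Realize (Sum.elim p fun _ => a) ∧
      ∀ a', φ.Realize (Sum.elim p fun _ => a') → a ≤ a' := by
  have hB := models_basic_of_T2 hM
  -- Without a least witness, every witness has a smaller one. Induction on `a` then finds a witness
  -- at least `a` below `b` for every `a`. Stating this as `v + a ≤ b` avoids subtraction and keeps
  -- the formula Σᵇᵢ₊₁.
  by_contra! hmin
  have hind := (realize_indAxiom _).1
    (hM.realize_of_mem _ (Or.inr ⟨_, _, hφ.complementary, rfl⟩)) (Fin.snoc p b)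
  simp only [realize_complementary] at hind
  obtain ⟨v, -, hv, -⟩ := hind ⟨b, le_rfl, (addV_zeroV hB b).le, hb⟩ (by
    rintro a ⟨v, hvb, hva, hv⟩
    obtain ⟨u, hu, huv⟩ := hmin v hv
    refine ⟨u, huv.le.trans hvb, ?_, hu⟩
    -- From `u < v` follows `u + 1 ≤ v`, hence `u + (a + 1) ≤ v + a ≤ b`.
    rw [addV_succV hB, ← succV_addV hB]
    refine le_trans ?_ hva
    rw [addV_comm hB, addV_comm hB v, addV_le_addV_iff hB]
    exact (lt_iff_succV_le hB).1 huv) (succV b)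
  -- At `a = b + 1` the inequality would force `b + 1 ≤ b`.
  rw [addV_comm hB] at hv
  exact ((lt_succV hB b).trans_le ((le_addV hB _ _).trans hv)).false

/-- A least counterexample to polynomial induction is nonzero, and its half is a smaller
counterexample. The negated formula is Πᵇᵢ₊₁, so it lifts to Σᵇᵢ₊₂, where minimization is available.
-/
theorem models_S2_of_T2 {i : ℕ} (hM : M ⊨ T2 (i + 2)) : M ⊨ S2 (i + 1) := by
  have hB := models_basic_of_T2 hM
  refine ⟨fun σ hσ => ?_⟩
  rcases hσ with hσ | ⟨n, φ, hφ, rfl⟩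
  · exact hM.realize_of_mem _ (Or.inl hσ)
  rw [realize_pindAxiom]
  intro p h0 hstep
  by_contra! ⟨b, hb⟩
  obtain ⟨a, ha, hmin⟩ := exists_least hM (φ := ∼φ) (.lift _ (.not (p := .pi) hφ)) p
    (b := b) (by simpa using hb)
  simp only [Formula.realize_not] at ha hmin
  have ha0 : a ≠ zeroV := by
    rintro rfl
    exact ha h0
  exact (halfV_lt hB ha0).not_ge (hmin _ fun h => ha (hstep a h))

end LeastNumber

end BoundedArith

namespace BoundedArith

/-! ### The search argument in a model -/

section Search

variable {M : Type} [Lang.Structure M]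

/-- Identifies occurrences of the bound `2 ^ d(|x|)` in different variable contexts with the single
value `pow2V`. -/
theorem realize_pow2Term_congr {β γ : Type} {v : β → M} {w : γ → M} {x : Lang.Term β}
    {y : Lang.Term γ} (h : x.realize v = y.realize w) (d : ℕ[X]) :
    (pow2Term d x).realize v = (pow2Term d y).realize w := by
  unfold pow2Term
  induction coeffList d with
  | nil => simp [pow2Horner]
  | cons a l ih =>
    simp only [pow2Horner]
    induction a with
    | zero => simp [ih, h]
    | succ a iha => simp only [Function.iterate_succ_apply', realize_dbl, iha]

/-- The value of `2 ^ d(|x|)`. -/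
noncomputable def pow2V (d : ℕ[X]) (x : M) : M :=
  (pow2Term d (Term.var ())).realize fun _ : Unit => x

variable [LinearOrder M] [Lang.OrderedStructure M]

namespace NPLS

/-- The semantic content of the conditions on an nPLS problem in a structure, apart from the
uniqueness of the neighbour function. -/
structure HoldsIn (P : NPLS) (M : Type) [Lang.Structure M] [LinearOrder M] : Prop where
  src_lt {x s : M} : fn P.src ![x, s] = succV zeroV → s < pow2V P.d x
  tgt_lt {x s y : M} : fn P.tgt ![x, s, y] = succV zeroV → y < pow2V P.d x
  gen_src {x s y : M} : fn P.tgt ![x, s, y] = succV zeroV →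
    fn P.src ![x, fn P.S ![x, s, y] ] = succV zeroV
  nbh_tgt {x s y z : M} : fn P.nbh ![x, s, y, z] = succV zeroV →
    fn P.tgt ![x, s, y] = succV zeroV ∧ fn P.tgt ![x, s, z] = succV zeroV
  rank_zero {x s y : M} : fn P.rk ![x, s] = zeroV → fn P.tgt ![x, s, y] = succV zeroV →
    fn P.nbh ![x, s, y, fn P.N ![x, s, y] ] = succV zeroV
  rank_pos {x s y : M} : zeroV < fn P.rk ![x, s] → fn P.tgt ![x, s, y] = succV zeroV →
    fn P.nbh ![x, s, y, y] = succV zeroV ∨ fn P.rk ![x, fn P.S ![x, s, y] ] < fn P.rk ![x, s]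
  extract {x s y z : M} : zeroV < fn P.rk ![x, s] →
    fn P.nbh ![x, fn P.S ![x, s, y], z, z] = succV zeroV →
    fn P.nbh ![x, s, y, fn P.U ![x, s, y, z] ] = succV zeroV
  init_src (x : M) : fn P.src ![x, fn P.i ![x] ] = succV zeroV
  init_tgt {x s : M} : fn P.src ![x, s] = succV zeroV →
    fn P.tgt ![x, s, fn P.t ![x, s] ] = succV zeroV
  cost {x s y z : M} : fn P.nbh ![x, s, y, z] = succV zeroV →
    y = z ∨ fn P.c ![x, z] < fn P.c ![x, y]

theorem IsNPLSIn.holdsIn {P : NPLS} {Th : Lang.Theory} (hP : P.IsNPLSIn Th) (hM : M ⊨ Th)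
    (hB : M ⊨ BASIC) : P.HoldsIn M := by
  have hne : Nonempty M := ⟨zeroV⟩
  have inst {φ : Lang.BoundedFormula Empty 4} (h : Th ⊨ᵇ φ) (x s y z : M) :
      φ.Realize (default : Empty → M) ![x, s, y, z] := h.realize_boundedFormula M
  have bound {x s y z a : M} (h : lenV a ≤ (polyTerm P.d (len (&0))).realize
      (Sum.elim (default : Empty → M) ![x, s, y, z])) : a < pow2V P.d x :=
    (lt_pow2Term hB _ _ _ h).trans_eq (realize_pow2Term_congr (by simp) _)
  constructor
  · intro x s h
    have := inst hP.src_bound x s s s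
    simp only [Src, BoundedFormula.realize_imp, Term.realize_le, realize_len] at this
    exact bound (this (by simpa using h))
  · intro x s y h
    have := inst hP.tgt_bound x s y y
    simp only [Tgt, BoundedFormula.realize_imp, Term.realize_le, realize_len] at this
    exact bound (this (by simpa using h))
  · intro x s y h
    simpa [Src, Tgt, h] using inst hP.gen_src x s y y
  · intro x s y z h
    have := inst hP.nbh_dom x s y z
    simp [Nbh, Src, Tgt, h] at this
    exact this.2
  · intro x s y h₁ h₂
    -- Only the existence direction of the equivalence is kept, with `z := N(x,s,y)`.
    simpa [Nbh, Tgt, h₁, h₂] using inst hP.rank_zero x s y (fn P.N ![x, s, y])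
  · intro x s y h₁ h₂
    simpa [Nbh, Tgt, h₁, h₂] using inst hP.rank_pos x s y y
  · intro x s y z h₁ h₂
    simpa [Nbh, h₁, h₂] using inst hP.extract x s y z
  · intro x
    simpa [Src] using inst hP.init_src x x x x
  · intro x s h
    simpa [Src, Tgt, h] using inst hP.init_tgt x s s s
  · intro x s y z h
    simpa [Nbh, h] using inst hP.cost x s y z

/-- The formula `∃ y ≤ b, y ∈ 𝒯(x,s) ∧ c(x,y) = a` with parameters `x, s, b`. -/
def costFormula (P : NPLS) : Lang.Formula (Fin 3 ⊕ Unit) :=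
  let x : Lang.Term ((Fin 3 ⊕ Unit) ⊕ Fin 1) := Term.var (Sum.inl (Sum.inl 0))
  let s : Lang.Term ((Fin 3 ⊕ Unit) ⊕ Fin 1) := Term.var (Sum.inl (Sum.inl 1))
  bexLe (Term.var (Sum.inl (Sum.inl 2)))
    (app P.tgt ![x, s, &0] =' 1 ⊓ app P.c ![x, &0] =' Term.var (Sum.inl (Sum.inr ())))

theorem hier_costFormula (P : NPLS) (i : ℕ) : Hier .sigma (i + 1) P.costFormula :=
  .boundedEx _ (.inf (.equal _ _ _ _) (.equal _ _ _ _))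

theorem realize_costFormula (P : NPLS) (x s b a : M) :
    P.costFormula.Realize (Sum.elim ![x, s, b] fun _ => a) ↔
      ∃ y ≤ b, fn P.tgt ![x, s, y] = succV zeroV ∧ fn P.c ![x, y] = a := by
  rw [costFormula, Formula.Realize, realize_bexLe]
  simp [Fin.snoc]

/-- The formula `∃ s ≤ b, s ∈ 𝒮(x) ∧ rk(x,s) = a ∧ ∀ y ≤ b, ¬𝒩(x,s,y,y)` with parameters
`x, b`. -/
def rankFormula (P : NPLS) : Lang.Formula (Fin 2 ⊕ Unit) :=
  let x {n : ℕ} : Lang.Term ((Fin 2 ⊕ Unit) ⊕ Fin n) := Term.var (Sum.inl (Sum.inl 0))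
  let b {n : ℕ} : Lang.Term ((Fin 2 ⊕ Unit) ⊕ Fin n) := Term.var (Sum.inl (Sum.inl 1))
  bexLe b (app P.src ![x, &0] =' 1 ⊓
    (app P.rk ![x, &0] =' Term.var (Sum.inl (Sum.inr ())) ⊓
      ballLe b ∼(app P.nbh ![x, &0, &1, &1] =' 1)))

/-- Having no solution is a Πᵇ₁ condition on the source; quantifying over sources makes it Σᵇ₂,
hence the minimization of rank uses the second level. -/
theorem hier_rankFormula (P : NPLS) (i : ℕ) : Hier .sigma (i + 2) P.rankFormula :=
  .boundedEx _ (.inf (.equal _ _ _ _) (.inf (.equal _ _ _ _)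
    (.lift _ (.boundedAll _ (.not (.equal _ _ _ _))))))

theorem realize_rankFormula (P : NPLS) (x b a : M) :
    P.rankFormula.Realize (Sum.elim ![x, b] fun _ => a) ↔
      ∃ s ≤ b, fn P.src ![x, s] = succV zeroV ∧ fn P.rk ![x, s] = a ∧
        ∀ y ≤ b, fn P.nbh ![x, s, y, y] ≠ succV zeroV := by
  rw [rankFormula, Formula.Realize, realize_bexLe]
  simp [Fin.snoc, realize_ballLe]

/-- The attained costs form a Σᵇ₁ set, since targets are bounded, and the initial target makes it
nonempty. -/
theorem HoldsIn.exists_min_cost {P : NPLS} (h : P.HoldsIn M) {i : ℕ} (hM : M ⊨ T2 (i + 1))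
    {x s : M} (hs : fn P.src ![x, s] = succV zeroV) :
    ∃ y, fn P.tgt ![x, s, y] = succV zeroV ∧
      ∀ z, fn P.tgt ![x, s, z] = succV zeroV → fn P.c ![x, y] ≤ fn P.c ![x, z] := by
  have ht := h.init_tgt hs
  obtain ⟨a, ha, hmin⟩ := exists_least hM (P.hier_costFormula i) ![x, s, pow2V P.d x]
    ((P.realize_costFormula _ _ _ _).2 ⟨_, (h.tgt_lt ht).le, ht, rfl⟩)
  obtain ⟨y, -, hy, rfl⟩ := (P.realize_costFormula _ _ _ _).1 ha
  exact ⟨y, hy, fun z hz =>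
    hmin _ ((P.realize_costFormula _ _ _ _).2 ⟨z, (h.tgt_lt hz).le, hz, rfl⟩)⟩

theorem HoldsIn.exists_solution {P : NPLS} (h : P.HoldsIn M) {i : ℕ} (hM : M ⊨ T2 (i + 2))
    {x s : M} (hs : fn P.src ![x, s] = succV zeroV) :
    ∃ y, fn P.nbh ![x, s, y, y] = succV zeroV := by
  by_contra! hno
  obtain ⟨r, hr, hmin⟩ := exists_least hM (P.hier_rankFormula i) ![x, pow2V P.d x]
    ((P.realize_rankFormula _ _ _).2 ⟨s, (h.src_lt hs).le, hs, rfl, fun y _ => hno y⟩)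
  obtain ⟨s, -, hs, rfl, hno⟩ := (P.realize_rankFormula _ _ _).1 hr
  obtain ⟨y, hy, hcost⟩ := h.exists_min_cost hM hs
  -- `rankFormula` excludes only solutions up to the bound, but every target lies below it.
  have hyy : fn P.nbh ![x, s, y, y] ≠ succV zeroV := hno y (h.tgt_lt hy).le
  have hstuck (z : M) : fn P.nbh ![x, s, y, z] ≠ succV zeroV := fun hz => by
    rcases h.cost hz with rfl | hlt
    · exact hyy hz
    · exact hlt.not_ge (hcost z (h.nbh_tgt hz).2)
  rcases (zeroV_le (models_basic_of_T2 hM) (fn P.rk ![x, s])).eq_or_lt with h0 | hpos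
  · exact hstuck _ (h.rank_zero h0.symm hy)
  · have hlt := (h.rank_pos hpos hy).resolve_left hyy
    -- The generated source also has no solution, since `U` would turn one into a neighbour of `y`.
    -- Its smaller rank contradicts minimality.
    refine hlt.not_ge (hmin _ ((P.realize_rankFormula _ _ _).2
      ⟨_, (h.src_lt (h.gen_src hy)).le, h.gen_src hy, rfl, fun z _ hz => ?_⟩))
    exact hstuck _ (h.extract hpos hz)

theorem HoldsIn.realize_totality {P : NPLS} (h : P.HoldsIn M) {i : ℕ} (hM : M ⊨ T2 (i + 2)) :
    M ⊨ P.totality := by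
  simp only [totality, Sentence.Realize, Formula.Realize, BoundedFormula.realize_all,
    BoundedFormula.realize_ex, BoundedFormula.realize_inf, realize_lt]
  intro x
  obtain ⟨y, hy⟩ := h.exists_solution hM (h.init_src x)
  refine ⟨y, (h.tgt_lt (h.nbh_tgt hy).1).trans_eq (realize_pow2Term_congr ?_ _), ?_⟩
  · simp [Fin.snoc]
  · simpa [Sol, Nbh, Fin.snoc] using hy

end NPLS

end Search

end BoundedArith

/-! ### From models to provability -/

open BoundedArith in
theorem totality_of_isNPLSIn {P : NPLS} (i : ℕ) (hP : P.IsNPLSIn (S2 (i + 1))) :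
    T2 (i + 2) ⊨ᵇ P.totality := by
  refine Theory.models_sentence_iff.2 fun M => ?_
  have hM : M ⊨ T2 (i + 2) := M.is_model
  have hB := models_basic_of_T2 hM
  let _ := linearOrder hB
  -- The order just introduced is by construction the interpretation of the symbol `≤`.
  have : Lang.OrderedStructure M :=
    inferInstanceAs (@Lang.OrderedStructure M _ (Lang.leOfStructure M) _)
  exact (hP.holdsIn (models_S2_of_T2 hM) hB).realize_totality hM

theorem lemma1 (P : BoundedArith.NPLS) (hP : P.IsNPLSIn (BoundedArith.S2 1)) :
    BoundedArith.T2 2 ⊨ᵇ P.totality :=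
  totality_of_isNPLSIn 0 hP
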